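/- Let $h \ge 6$ and let $Q_h$ be the $h$-dimensional hypercube, i.e. the graph whose vertices are the binary strings of length $h$, two of them being adjacent if and only if they differ in exactly one position. Let $M \subseteq V(Q_h)$ be a mutual-visibility set of $Q_h$, i.e. a set such that for all $u, v \in M$ there is a shortest $u,v$-path in $Q_h$ containing no vertex of $M \setminus \{u, v\}$. If some subset $Y \subseteq M$ induces a subgraph $Q_h[Y]$ isomorphic to the complete bipartite graph $K_{1,4}$, then $$|M| \le 2^{h-1} - 2.$$ -/

import Mathlib

/-- The hypercube `Q_h`: the vertices are the binary strings of length `h`, two of them being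
adjacent when their Hamming distance is one. -/
def hypercube (h : ℕ) : SimpleGraph (Fin h → Bool) where
  Adj x y := hammingDist x y = 1
  symm := ⟨fun x y hxy => by rw [hammingDist_comm]; exact hxy⟩
  loopless := ⟨fun x hx => by simp at hx⟩

/-- `u` and `v` are `M`-visible in `G`: there is a shortest `u,v`-path in `G` that contains no
vertex of `M \ {u, v}`. -/
def MVisible {V : Type*} (G : SimpleGraph V) (M : Set V) (u v : V) : Prop :=
  ∃ p : G.Walk u v, p.IsPath ∧ p.length = G.dist u v ∧ ∀ x ∈ p.support, x ∉ M \ {u, v}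

/-- `M` is a mutual-visibility set of `G`: any two vertices of `M` are `M`-visible. -/
def IsMutualVisibilitySet {V : Type*} (G : SimpleGraph V) (M : Set V) : Prop :=
  ∀ u ∈ M, ∀ v ∈ M, MVisible G M u v

/-!
A mutual-visibility set `M` of `Q_h` cannot contain, inside any subcube, one of three
configurations (`IsMutualVisibilitySet.obstructionFree`):

* the four vertices of a square;
* in a 3-cube, a vertex with its three neighbours and its antipode;
* in a 3-cube, the six vertices left after deleting an antipodal pair.

In the first two the first vertex of a shortest path between antipodes is forced into `M`, in the
third the first or the second one is. A set without these configurations has at most 5 points in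
every 3-cube, and a 3-cube with 5 points looks the same up to symmetry. Starting from such a
3-cube, a branch-and-bound search over the remaining 8 or 24 vertices, `refute`, run by the kernel
and proved sound in `sum_lt_of_refute`, shows that a 4-cube has at most 9 points
(`faceCard_fourCube_le`) and a 5-cube at most 16 (`faceCard_fiveCube_le`).

Let `c` be the centre of a star `K_{1,4}` in `M`, with directions `D`. No further point of `M`
lies in the 4-cube through `c` spanned by `D`, since every shortest path inside it leaves `c`
through a leaf (`faceCard_le_of_star`). So that 4-cube has at most 5 points, and a 5-cube spanned
by `D` and one more direction at `c` has at most `5 + 9 = 14`. Its `2 ^ (h - 5)` parallel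
translates partition `Q_h`, and the others have at most 16 points each, whence
`|M| ≤ 16 * 2 ^ (h - 5) - 2`.
-/

/-! ### Obstruction-free sets of vertices encoded as numbers -/

/-- The three kinds of obstruction in the `n`-cube, each as its list of vertices. A vertex is a
number `q < 2 ^ n` whose binary digits are its coordinates, so that `q ^^^ 2 ^ i` is its neighbour
in direction `i`. Every obstruction occurs, some of them several times. -/
def obstructions (n : ℕ) : List (List ℕ) :=
  (List.range (2 ^ n)).flatMap fun x =>
    (List.range n).flatMap fun i => (List.range i).flatMap fun j =>
      [x, x ^^^ 2 ^ i, x ^^^ 2 ^ j, x ^^^ 2 ^ i ^^^ 2 ^ j] ::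
        (List.range j).flatMap fun k =>
          [[x, x ^^^ 2 ^ i, x ^^^ 2 ^ j, x ^^^ 2 ^ k, x ^^^ 2 ^ i ^^^ 2 ^ j ^^^ 2 ^ k],
            [x ^^^ 2 ^ i, x ^^^ 2 ^ j, x ^^^ 2 ^ k, x ^^^ 2 ^ i ^^^ 2 ^ j,
              x ^^^ 2 ^ i ^^^ 2 ^ k, x ^^^ 2 ^ j ^^^ 2 ^ k]]

/-- A set of vertices of the `n`-cube is encoded by the number `m` whose bit `q` tells whether the
vertex `q` belongs to it. This says that the set contains no obstruction. -/
def AvoidsObstructions (n m : ℕ) : Prop :=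
  ∀ l ∈ obstructions n, ¬ ∀ q ∈ l, m.testBit q = true

/-- The number whose bits are set exactly at the positions in `l`. -/
def bitMask (l : List ℕ) : ℕ := l.foldr (fun q m => 2 ^ q ||| m) 0

theorem testBit_bitMask (l : List ℕ) (q : ℕ) : (bitMask l).testBit q = true ↔ q ∈ l := by
  induction l with
  | nil => simp [bitMask]
  | cons a l ih =>
    have h : bitMask (a :: l) = 2 ^ a ||| bitMask l := rfl
    rw [h, Nat.testBit_or, Bool.or_eq_true, ih, Nat.testBit_two_pow, List.mem_cons]
    simp [eq_comm]

theorem AvoidsObstructions.land_ne {n m : ℕ} (hm : AvoidsObstructions n m) :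
    ∀ F ∈ (obstructions n).map bitMask, Nat.land m F ≠ F := by
  intro F hF h
  obtain ⟨l, hl, rfl⟩ := List.mem_map.1 hF
  refine hm l hl fun q hq => ?_
  have h1 := (testBit_bitMask l q).2 hq
  rw [← h] at h1
  have h2 : (m &&& bitMask l).testBit q = true := h1
  rw [Nat.testBit_and, Bool.and_eq_true] at h2
  exact h2.1

/-! ### Branch-and-bound search -/

/-- The entry for the vertex `q`, `p ≤ q < 2 ^ n`, lists the masks of the obstructions whose
largest vertex is `q`; these are the ones that can be completed by deciding that `q` belongs to
the set. -/
def obstructionTable (n p : ℕ) : List (List ℕ) :=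
  (List.range' p (2 ^ n - p)).map fun q =>
    ((obstructions n).map bitMask).filter fun F => Nat.beq (F >>> q) 1

/-- Branch and bound. `refute N t p m need` returns `true` only if no set extending `m`, the part
of the set below `p`, has `need` or more further points in `[p, N)` and contains none of the masks
in `t`, whose entries belong to the vertices `p, …, N - 1`. A branch is cut when `need` exceeds `5
* ((N - p) / 8) + (N - p) % 8`, a bound for the number of further points that holds when each
aligned block of eight vertices has at most five. The operations `Nat.land`, `Nat.lor`, `Nat.beq`
and `Nat.ble` are used directly because the kernel evaluates them on numerals. -/
def refute (N : ℕ) : List (List ℕ) → ℕ → ℕ → ℕ → Bool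
  | [], _, _, need => Nat.ble 1 need
  | fs :: t, p, m, need =>
      Nat.ble (5 * ((N - p) / 8) + (N - p) % 8 + 1) need ||
        (refute N t (p + 1) m need &&
          (fs.any (fun F => Nat.beq (Nat.land (Nat.lor m (2 ^ p)) F) F) ||
            refute N t (p + 1) (Nat.lor m (2 ^ p)) (need - 1)))

theorem mod_two_pow_succ_of_testBit {M p : ℕ} (h : M.testBit p = true) :
    M % 2 ^ (p + 1) = Nat.lor (M % 2 ^ p) (2 ^ p) := by
  change _ = M % 2 ^ p ||| 2 ^ p
  apply Nat.eq_of_testBit_eq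
  intro i
  rw [Nat.testBit_or, Nat.testBit_mod_two_pow, Nat.testBit_mod_two_pow, Nat.testBit_two_pow]
  rcases lt_trichotomy i p with hi | rfl | hi
  · simp [hi, hi.ne', Nat.lt_succ_of_lt hi]
  · simp [h]
  · simp [hi.ne, not_lt.2 hi.le, show ¬ i < p + 1 by omega]

theorem mod_two_pow_succ_of_not_testBit {M p : ℕ} (h : M.testBit p = false) :
    M % 2 ^ (p + 1) = M % 2 ^ p := by
  apply Nat.eq_of_testBit_eq
  intro i
  rw [Nat.testBit_mod_two_pow, Nat.testBit_mod_two_pow]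
  rcases lt_trichotomy i p with hi | rfl | hi
  · simp [hi, Nat.lt_succ_of_lt hi]
  · simp [h]
  · simp [not_lt.2 hi.le, show ¬ i < p + 1 by omega]

theorem land_eq_of_mod_land_eq {M F k : ℕ} (h : Nat.land (M % 2 ^ k) F = F) :
    Nat.land M F = F := by
  change M &&& F = F
  change (M % 2 ^ k) &&& F = F at h
  apply Nat.eq_of_testBit_eq
  intro i
  have h1 := congrArg (fun a => Nat.testBit a i) h
  simp only [Nat.testBit_and, Nat.testBit_mod_two_pow] at h1 ⊢
  revert h1
  cases F.testBit i <;> simp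

/-- Soundness of `refute`. The hypothesis `hcap` is the bound by which it cuts branches. -/
theorem sum_lt_of_refute {M N : ℕ}
    (hcap : ∀ p ≤ N, ∑ q ∈ Finset.Ico p N, (M.testBit q).toNat ≤ 5 * ((N - p) / 8) + (N - p) % 8)
    (t : List (List ℕ)) :
    ∀ p m need, p + t.length = N → M % 2 ^ p = m →
      (∀ fs ∈ t, ∀ F ∈ fs, Nat.land M F ≠ F) → refute N t p m need = true →
      ∑ q ∈ Finset.Ico p N, (M.testBit q).toNat < need := by
  induction t with
  | nil =>
    intro p m need hp _ _ hr
    simp only [List.length_nil, add_zero] at hp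
    subst hp
    simpa [refute, Nat.succ_le_iff] using hr
  | cons fs t ih =>
    intro p m need hp hm ht hr
    rw [List.length_cons] at hp
    have hpN : p < N := by omega
    rw [refute, Bool.or_eq_true, Bool.and_eq_true, Bool.or_eq_true] at hr
    rcases hr with hr | ⟨h0, h1⟩
    · exact lt_of_le_of_lt (hcap p hpN.le) (Nat.le_of_ble_eq_true hr)
    have ht' : ∀ gs ∈ t, ∀ F ∈ gs, Nat.land M F ≠ F :=
      fun gs hgs => ht gs (List.mem_cons_of_mem _ hgs)
    rw [Finset.sum_eq_sum_Ico_succ_bot hpN]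
    cases hb : M.testBit p with
    | false =>
      simpa using ih (p + 1) m need (by omega)
        (by rw [mod_two_pow_succ_of_not_testBit hb, hm]) ht' h0
    | true =>
      have hm' : M % 2 ^ (p + 1) = Nat.lor m (2 ^ p) := by
        rw [mod_two_pow_succ_of_testBit hb, hm]
      rcases h1 with h1 | h1
      · obtain ⟨F, hF, hFm⟩ := List.any_eq_true.1 h1
        have hFm := Nat.eq_of_beq_eq_true hFm
        rw [← hm'] at hFm
        exact absurd (land_eq_of_mod_land_eq hFm) (ht fs List.mem_cons_self F hF)
      · have := ih (p + 1) _ (need - 1) (by omega) hm' ht' h1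
        simp only [Bool.toNat_true]
        omega

/-- If each of `B` consecutive blocks of length 8 has sum at most 5, then the last `d` terms have
sum at most `5 * (d / 8) + d % 8`: the complete blocks are bounded by 5 each, the other terms by 1
each. -/
theorem sum_Ico_le_of_block_le {f : ℕ → ℕ} (hf : ∀ q, f q ≤ 1) {B : ℕ}
    (hblock : ∀ j < B, ∑ q ∈ Finset.Ico (8 * j) (8 * j + 8), f q ≤ 5) (d : ℕ) :
    ∀ p, p + d = 8 * B → ∑ q ∈ Finset.Ico p (8 * B), f q ≤ 5 * (d / 8) + d % 8 := by
  induction d using Nat.strong_induction_on with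
  | _ d ih =>
    intro p hp
    rcases Nat.eq_zero_or_pos d with rfl | hd
    · simp [← hp]
    by_cases h8 : d % 8 = 0
    · have h1 := hblock (p / 8) (by omega)
      have hp8 : 8 * (p / 8) = p := by omega
      rw [hp8] at h1
      have h2 := ih (d - 8) (by omega) (p + 8) (by omega)
      rw [← Finset.sum_Ico_consecutive f (show p ≤ p + 8 by omega) (show p + 8 ≤ 8 * B by omega)]
      omega
    · have h2 := ih (d - 1) (by omega) (p + 1) (by omega)
      have h1 := hf p
      rw [Finset.sum_eq_sum_Ico_succ_bot (by omega)]
      omega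

set_option maxRecDepth 100000 in
theorem refute_fourCube : refute 16 (obstructionTable 4 8) 8 118 5 = true := by decide +kernel

set_option maxRecDepth 100000 in
theorem refute_fiveCube : refute 32 (obstructionTable 5 8) 8 118 12 = true := by decide +kernel

set_option maxRecDepth 100000 in
theorem exists_relabel_threeCube_fin : ∀ m : Fin 256,
    (∀ F ∈ (obstructions 3).map bitMask, Nat.land m.val F ≠ F) →
    5 ≤ ∑ q ∈ Finset.range 8, (m.val.testBit q).toNat →
    ∃ r : Fin 8, ∃ σ : Equiv.Perm (Fin 3), ∀ q : Fin 8,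
      m.val.testBit (r ^^^ Nat.ofBits fun k : Fin 3 => Nat.testBit q (σ k)) =
        Nat.testBit 118 q := by
  decide +kernel

/-- Uniqueness of the sets of five points in a 3-cube. Here `118` encodes `{1, 2, 4, 5, 6}`, the
hexagon between the vertices `0` and `7` without the vertex `3`; `r` is the new origin and `σ`
permutes the coordinates. -/
theorem exists_relabel_threeCube {m : ℕ} (hlt : m < 256) (hm : AvoidsObstructions 3 m)
    (h5 : 5 ≤ ∑ q ∈ Finset.range 8, (m.testBit q).toNat) :
    ∃ r < 8, ∃ σ : Equiv.Perm (Fin 3), ∀ q < 8,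
      m.testBit (r ^^^ Nat.ofBits fun k : Fin 3 => Nat.testBit q (σ k)) = Nat.testBit 118 q := by
  obtain ⟨r, σ, h⟩ := exists_relabel_threeCube_fin ⟨m, hlt⟩ hm.land_ne h5
  exact ⟨r, r.2, σ, fun q hq => h ⟨q, hq⟩⟩

set_option maxRecDepth 100000 in
theorem sum_threeCube_le_fin : ∀ m : Fin 256,
    (∀ F ∈ (obstructions 3).map bitMask, Nat.land m.val F ≠ F) →
    ∑ q ∈ Finset.range 8, (m.val.testBit q).toNat ≤ 5 := by
  decide +kernel

theorem sum_threeCube_le {m : ℕ} (hlt : m < 256) (hm : AvoidsObstructions 3 m) :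
    ∑ q ∈ Finset.range 8, (m.testBit q).toNat ≤ 5 :=
  sum_threeCube_le_fin ⟨m, hlt⟩ hm.land_ne

/-- An obstruction-free set whose first block of eight vertices is the normalized five-point set
has fewer than `need + 5` points, provided that `refute` succeeds on the remaining vertices. `B`
is the number of blocks. -/
theorem sum_lt_of_refute_of_block_le {n B m need : ℕ} (hB : 2 ^ n = 8 * B) (h8 : 1 ≤ B)
    (hm : AvoidsObstructions n m) (hlow : m % 2 ^ 8 = 118)
    (hblock : ∀ j < B, ∑ q ∈ Finset.Ico (8 * j) (8 * j + 8), (m.testBit q).toNat ≤ 5)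
    (hr : refute (2 ^ n) (obstructionTable n 8) 8 118 need = true) :
    ∑ q ∈ Finset.range (2 ^ n), (m.testBit q).toNat < need + 5 := by
  have h := sum_lt_of_refute (M := m) (N := 2 ^ n)
    (fun p hp => by
      rw [hB] at hp ⊢
      exact sum_Ico_le_of_block_le (fun q => Bool.toNat_le _) hblock _ p (by omega))
    (obstructionTable n 8) 8 118 need (by simp [obstructionTable]; omega) hlow
    (by
      intro fs hfs F hF
      obtain ⟨q, -, rfl⟩ := List.mem_map.1 hfs
      exact hm.land_ne F (List.mem_of_mem_filter hF)) hr
  have h0 := hblock 0 (by omega)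
  rw [Finset.range_eq_Ico, ← Finset.sum_Ico_consecutive _ (Nat.zero_le 8) (by omega)]
  simp only [mul_zero, zero_add] at h0
  omega

/-! ### Subcubes of the hypercube and their coordinates -/

/-- The neighbour of `x` in direction `i`. -/
def flipAt {h : ℕ} (x : Fin h → Bool) (i : Fin h) : Fin h → Bool := Function.update x i (!x i)

@[simp] theorem flipAt_self {h : ℕ} (x : Fin h → Bool) (i : Fin h) : flipAt x i i = !x i := by
  simp [flipAt]

theorem flipAt_of_ne {h : ℕ} (x : Fin h → Bool) {i j : Fin h} (hij : j ≠ i) :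
    flipAt x i j = x j := by
  simp [flipAt, hij]

/-- `M` contains none of the three configurations that mutual visibility forbids in a square or a
3-cube. -/
structure ObstructionFree {h : ℕ} (M : Finset (Fin h → Bool)) : Prop where
  square : ∀ x i j, i ≠ j → x ∈ M → flipAt x i ∈ M → flipAt x j ∈ M → flipAt (flipAt x i) j ∉ M
  claw : ∀ x i j k, i ≠ j → i ≠ k → j ≠ k → x ∈ M → flipAt x i ∈ M → flipAt x j ∈ M →
    flipAt x k ∈ M → flipAt (flipAt (flipAt x i) j) k ∉ M
  hexagon : ∀ x i j k, i ≠ j → i ≠ k → j ≠ k → flipAt x i ∈ M → flipAt x j ∈ M →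
    flipAt x k ∈ M → flipAt (flipAt x i) j ∈ M → flipAt (flipAt x i) k ∈ M →
    flipAt (flipAt x j) k ∉ M

/-- The vertex with binary digits `q` of the cube through `z` with directions `s 0, …, s (n - 1)`:
the coordinate `s k` of `z` is flipped when bit `k` of `q` is set. -/
def cubePoint {h n : ℕ} (z : Fin h → Bool) (s : Fin n → Fin h) (q : ℕ) : Fin h → Bool :=
  fun i => xor (z i) (decide (∃ k, s k = i ∧ q.testBit k = true))

theorem cubePoint_apply_of_forall_ne {h n : ℕ} (z : Fin h → Bool) (s : Fin n → Fin h) (q : ℕ)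
    {i : Fin h} (hi : ∀ k, s k ≠ i) : cubePoint z s q i = z i := by
  simp [cubePoint, hi]

theorem cubePoint_apply {h n : ℕ} (z : Fin h → Bool) {s : Fin n → Fin h}
    (hs : Function.Injective s) (q : ℕ) (k : Fin n) :
    cubePoint z s q (s k) = xor (z (s k)) (q.testBit k) := by
  simp [cubePoint, hs.eq_iff]

theorem eq_of_eq_on_range_of_eq_off_range {h n : ℕ} {s : Fin n → Fin h} {x y : Fin h → Bool}
    (hin : ∀ k, x (s k) = y (s k)) (hout : ∀ i, (∀ k, s k ≠ i) → x i = y i) : x = y := by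
  funext i
  by_cases hi : ∃ k, s k = i
  · obtain ⟨k, rfl⟩ := hi
    exact hin k
  · exact hout i (not_exists.1 hi)

theorem cubePoint_xor_two_pow {h n : ℕ} (z : Fin h → Bool) {s : Fin n → Fin h}
    (hs : Function.Injective s) (q : ℕ) (k : Fin n) :
    cubePoint z s (q ^^^ 2 ^ (k : ℕ)) = flipAt (cubePoint z s q) (s k) := by
  refine eq_of_eq_on_range_of_eq_off_range (s := s) (fun l => ?_) fun i hi => ?_
  · rw [cubePoint_apply z hs, Nat.testBit_xor, Nat.testBit_two_pow]
    by_cases hl : l = k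
    · subst hl
      rw [flipAt_self, cubePoint_apply z hs]
      simp
    · rw [flipAt_of_ne _ (hs.ne hl), cubePoint_apply z hs]
      have : (k : ℕ) ≠ l := fun h => hl (Fin.ext h.symm)
      simp [this]
  · rw [flipAt_of_ne _ (hi k).symm, cubePoint_apply_of_forall_ne _ _ _ hi,
      cubePoint_apply_of_forall_ne _ _ _ hi]

theorem cubePoint_cubePoint {h n : ℕ} (z : Fin h → Bool) {s : Fin n → Fin h}
    (hs : Function.Injective s) (p q : ℕ) :
    cubePoint (cubePoint z s p) s q = cubePoint z s (p ^^^ q) := by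
  refine eq_of_eq_on_range_of_eq_off_range (s := s) (fun l => ?_) fun i hi => ?_
  · simp only [cubePoint_apply _ hs, Nat.testBit_xor, Bool.xor_assoc]
  · simp only [cubePoint_apply_of_forall_ne _ _ _ hi]

theorem cubePoint_ofBits_perm {h n : ℕ} (z : Fin h → Bool) (s : Fin n → Fin h)
    (σ : Equiv.Perm (Fin n)) (q : ℕ) :
    cubePoint z s (Nat.ofBits fun k : Fin n => q.testBit (σ k)) =
      cubePoint z (s ∘ σ.symm) q := by
  funext i
  unfold cubePoint
  congr 2
  apply propext
  constructor
  · rintro ⟨k, hk, hq⟩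
    exact ⟨σ k, by simpa using hk, by simpa using hq⟩
  · rintro ⟨k, hk, hq⟩
    exact ⟨σ.symm k, hk, by simpa using hq⟩

theorem cubePoint_comp_castLE {h n d : ℕ} (hd : d ≤ n) (z : Fin h → Bool) (s : Fin n → Fin h)
    {q : ℕ} (hq : q < 2 ^ d) :
    cubePoint z (s ∘ Fin.castLE hd) q = cubePoint z s q := by
  funext i
  unfold cubePoint
  congr 2
  apply propext
  constructor
  · rintro ⟨k, hk, hq⟩
    exact ⟨Fin.castLE hd k, hk, hq⟩
  · rintro ⟨k, hk, hk'⟩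
    have hkd : (k : ℕ) < d := by
      by_contra hcon
      rw [Nat.testBit_lt_two_pow
        (hq.trans_le (Nat.pow_le_pow_right two_pos (not_lt.1 hcon)))] at hk'
      exact absurd hk' (by simp)
    exact ⟨⟨k, hkd⟩, hk, hk'⟩

/-- The trace of `M` on the cube through `z` with directions `s`, encoded as a number. -/
def traceMask {h n : ℕ} (M : Finset (Fin h → Bool)) (z : Fin h → Bool) (s : Fin n → Fin h) : ℕ :=
  Nat.ofBits fun q : Fin (2 ^ n) => decide (cubePoint z s q ∈ M)

theorem testBit_traceMask {h n : ℕ} (M : Finset (Fin h → Bool)) (z : Fin h → Bool)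
    (s : Fin n → Fin h) {q : ℕ} (hq : q < 2 ^ n) :
    (traceMask M z s).testBit q = decide (cubePoint z s q ∈ M) := by
  rw [traceMask, Nat.testBit_ofBits_lt _ _ hq]

theorem mem_of_testBit_traceMask {h n : ℕ} {M : Finset (Fin h → Bool)} {z : Fin h → Bool}
    {s : Fin n → Fin h} {q : ℕ} (hq : (traceMask M z s).testBit q = true) :
    cubePoint z s q ∈ M := by
  by_cases hlt : q < 2 ^ n
  · rw [testBit_traceMask M z s hlt] at hq
    exact of_decide_eq_true hq
  · rw [traceMask, Nat.testBit_ofBits_ge _ _ (not_lt.1 hlt)] at hq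
    exact absurd hq (by simp)

theorem ObstructionFree.avoidsObstructions {h n : ℕ} {M : Finset (Fin h → Bool)}
    (hM : ObstructionFree M) (z : Fin h → Bool) {s : Fin n → Fin h}
    (hs : Function.Injective s) : AvoidsObstructions n (traceMask M z s) := by
  intro l hl hall
  have hmem : ∀ q ∈ l, cubePoint z s q ∈ M := fun q hq => mem_of_testBit_traceMask (hall q hq)
  simp only [obstructions, List.mem_flatMap, List.mem_range, List.mem_cons] at hl
  obtain ⟨x, -, i, hi, j, hj, hl⟩ := hl
  have flip_i : ∀ q, cubePoint z s (q ^^^ 2 ^ i) = flipAt (cubePoint z s q) (s ⟨i, hi⟩) :=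
    fun q => cubePoint_xor_two_pow z hs q ⟨i, hi⟩
  have flip_j : ∀ q, cubePoint z s (q ^^^ 2 ^ j) = flipAt (cubePoint z s q) (s ⟨j, by omega⟩) :=
    fun q => cubePoint_xor_two_pow z hs q ⟨j, by omega⟩
  have hij : s ⟨i, hi⟩ ≠ s ⟨j, by omega⟩ := hs.ne (by simp; omega)
  rcases hl with rfl | ⟨k, hk, hl⟩
  · simp only [List.mem_cons, List.not_mem_nil, or_false, forall_eq_or_imp, forall_eq, flip_i,
      flip_j] at hmem
    obtain ⟨h0, h1, h2, h3⟩ := hmem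
    exact hM.square _ _ _ hij h0 h1 h2 h3
  have flip_k : ∀ q, cubePoint z s (q ^^^ 2 ^ k) = flipAt (cubePoint z s q) (s ⟨k, by omega⟩) :=
    fun q => cubePoint_xor_two_pow z hs q ⟨k, by omega⟩
  have hik : s ⟨i, hi⟩ ≠ s ⟨k, by omega⟩ := hs.ne (by simp; omega)
  have hjk : s ⟨j, by omega⟩ ≠ s ⟨k, by omega⟩ := hs.ne (by simp; omega)
  simp only [List.not_mem_nil, or_false] at hl
  rcases hl with rfl | rfl
  · simp only [List.mem_cons, List.not_mem_nil, or_false, forall_eq_or_imp, forall_eq, flip_i,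
      flip_j, flip_k] at hmem
    obtain ⟨h0, h1, h2, h3, h4⟩ := hmem
    exact hM.claw _ _ _ _ hij hik hjk h0 h1 h2 h3 h4
  · simp only [List.mem_cons, List.not_mem_nil, or_false, forall_eq_or_imp, forall_eq, flip_i,
      flip_j, flip_k] at hmem
    obtain ⟨h0, h1, h2, h3, h4, h5⟩ := hmem
    exact hM.hexagon _ _ _ _ hij hik hjk h0 h1 h2 h3 h4 h5

/-! ### Counting the points of a subcube -/

/-- The number of points of `M` in the subcube through `z` spanned by the directions in `D`.
Unlike `traceMask` it does not depend on the order of the directions, nor on which point of the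
subcube is taken as the origin. -/
def faceCard {h : ℕ} (M : Finset (Fin h → Bool)) (z : Fin h → Bool) (D : Finset (Fin h)) : ℕ :=
  (M.filter fun x => ∀ i ∉ D, x i = z i).card

theorem faceCard_congr {h : ℕ} (M : Finset (Fin h → Bool)) {z z' : Fin h → Bool}
    {D : Finset (Fin h)} (hz : ∀ i ∉ D, z' i = z i) : faceCard M z' D = faceCard M z D := by
  unfold faceCard
  congr 1
  refine Finset.filter_congr fun x _ => forall₂_congr fun i hi => ?_
  rw [hz i hi]

theorem sum_testBit_traceMask {h n : ℕ} (M : Finset (Fin h → Bool)) (z : Fin h → Bool)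
    {s : Fin n → Fin h} (hs : Function.Injective s) :
    ∑ q ∈ Finset.range (2 ^ n), ((traceMask M z s).testBit q).toNat =
      faceCard M z (Finset.univ.image s) := by
  have h1 : ∀ q ∈ Finset.range (2 ^ n), ((traceMask M z s).testBit q).toNat =
      if cubePoint z s q ∈ M then 1 else 0 := by
    intro q hq
    rw [testBit_traceMask M z s (Finset.mem_range.1 hq)]
    split_ifs with hc <;> simp [hc]
  rw [Finset.sum_congr rfl h1, ← Finset.card_filter, faceCard]
  refine Finset.card_bij (fun q _ => cubePoint z s q) ?_ ?_ ?_
  · intro q hq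
    refine Finset.mem_filter.2 ⟨(Finset.mem_filter.1 hq).2, fun i hi => ?_⟩
    exact cubePoint_apply_of_forall_ne z s q fun k hk =>
      hi (Finset.mem_image.2 ⟨k, Finset.mem_univ _, hk⟩)
  · intro p hp q hq hpq
    have hp := Finset.mem_range.1 (Finset.mem_filter.1 hp).1
    have hq := Finset.mem_range.1 (Finset.mem_filter.1 hq).1
    apply Nat.eq_of_testBit_eq
    intro i
    by_cases hi : i < n
    · have := congrFun hpq (s ⟨i, hi⟩)
      simpa [cubePoint_apply z hs] using this
    · rw [Nat.testBit_lt_two_pow (hp.trans_le (Nat.pow_le_pow_right two_pos (not_lt.1 hi))),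
        Nat.testBit_lt_two_pow (hq.trans_le (Nat.pow_le_pow_right two_pos (not_lt.1 hi)))]
  · intro x hx
    obtain ⟨hxM, hx⟩ := Finset.mem_filter.1 hx
    have key : cubePoint z s (Nat.ofBits fun k => xor (z (s k)) (x (s k))) = x := by
      refine eq_of_eq_on_range_of_eq_off_range (s := s) (fun k => ?_) fun i hi => ?_
      · rw [cubePoint_apply z hs, Nat.testBit_ofBits_lt _ _ k.2]
        simp
      · rw [cubePoint_apply_of_forall_ne z s _ hi, hx i]
        simpa using hi
    refine ⟨_, Finset.mem_filter.2 ⟨Finset.mem_range.2 (Nat.ofBits_lt_two_pow _), ?_⟩, key⟩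
    rw [key]
    exact hxM

theorem faceCard_insert {h : ℕ} (M : Finset (Fin h → Bool)) (z : Fin h → Bool)
    {D : Finset (Fin h)} {a : Fin h} (ha : a ∉ D) :
    faceCard M z (insert a D) = faceCard M z D + faceCard M (flipAt z a) D := by
  unfold faceCard
  rw [← Finset.card_filter_add_card_filter_not (fun x => x a = z a), Finset.filter_filter,
    Finset.filter_filter]
  congr 2
  · refine Finset.filter_congr fun x _ => ⟨fun hx i hi => ?_, fun hx => ⟨fun i hi => ?_, hx a ha⟩⟩
    · by_cases hia : i = a
      · exact hia ▸ hx.2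
      · exact hx.1 i (by simp [hia, hi])
    · exact hx i fun hiD => hi (Finset.mem_insert_of_mem hiD)
  · refine Finset.filter_congr fun x _ => ⟨fun hx i hi => ?_, fun hx => ⟨fun i hi => ?_, ?_⟩⟩
    · by_cases hia : i = a
      · subst hia
        rw [flipAt_self]
        exact Bool.eq_not_of_ne hx.2
      · rw [flipAt_of_ne _ hia]
        exact hx.1 i (by simp [hia, hi])
    · rw [Finset.mem_insert, not_or] at hi
      rw [hx i hi.2, flipAt_of_ne _ hi.1]
    · rw [hx a ha, flipAt_self]
      simp

/-- An aligned block of eight vertices of a cube is a 3-cube in the first three directions. -/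
theorem traceMask_block_le {h n : ℕ} {M : Finset (Fin h → Bool)} (hM : ObstructionFree M)
    (hn : 3 ≤ n) (z : Fin h → Bool) {s : Fin n → Fin h} (hs : Function.Injective s) {j : ℕ}
    (hj : 8 * j + 8 ≤ 2 ^ n) :
    ∑ q ∈ Finset.Ico (8 * j) (8 * j + 8), ((traceMask M z s).testBit q).toNat ≤ 5 := by
  have hs' : Function.Injective (s ∘ Fin.castLE hn) := hs.comp (Fin.castLE_injective hn)
  have h1 := sum_threeCube_le (Nat.ofBits_lt_two_pow _)
    (hM.avoidsObstructions (cubePoint z s (8 * j)) hs')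
  rw [Finset.sum_Ico_eq_sum_range]
  refine le_trans (le_of_eq ?_) h1
  rw [Nat.add_sub_cancel_left]
  refine Finset.sum_congr rfl fun r hr => ?_
  have hr := Finset.mem_range.1 hr
  have hxor : 8 * j ^^^ r = 8 * j + r := by
    apply Nat.eq_of_testBit_eq
    intro i
    rw [Nat.testBit_xor, show (8 : ℕ) = 2 ^ 3 from rfl, Nat.testBit_two_pow_mul_add _ hr,
      Nat.testBit_two_pow_mul]
    by_cases hi : i < 3
    · simp [hi, not_le.2 hi]
    · rw [Nat.testBit_lt_two_pow (lt_of_lt_of_le (show r < 2 ^ 3 from hr)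
        (Nat.pow_le_pow_right two_pos (not_lt.1 hi)))]
      simp [hi, not_lt.1 hi]
  rw [testBit_traceMask M z s (by omega),
    testBit_traceMask M (cubePoint z s (8 * j)) (s ∘ Fin.castLE hn) hr,
    cubePoint_comp_castLE hn _ s hr, cubePoint_cubePoint z hs, hxor]

/-! ### Bounds for subcubes of dimension four and five -/

/-- A 3-cube with at least five points of `M` can be coordinatized so that its trace is the
normalized five-point set. -/
theorem exists_normalized_threeCube {h : ℕ} {M : Finset (Fin h → Bool)} (hM : ObstructionFree M)
    (z : Fin h → Bool) {T : Finset (Fin h)} (hT : T.card = 3) (h5 : 5 ≤ faceCard M z T) :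
    ∃ z' : Fin h → Bool, (∀ i ∉ T, z' i = z i) ∧ ∃ s : Fin 3 → Fin h, Function.Injective s ∧
      Finset.univ.image s = T ∧ traceMask M z' s = 118 := by
  let s : Fin 3 → Fin h := fun k => (T.equivFinOfCardEq hT).symm k
  have hs : Function.Injective s :=
    Subtype.val_injective.comp (T.equivFinOfCardEq hT).symm.injective
  have himg : Finset.univ.image s = T := by
    refine Finset.eq_of_subset_of_card_le (fun i hi => ?_) ?_
    · obtain ⟨k, -, rfl⟩ := Finset.mem_image.1 hi
      exact ((T.equivFinOfCardEq hT).symm k).2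
    · rw [Finset.card_image_of_injective _ hs, hT]
      simp
  obtain ⟨r, hr, σ, hσ⟩ := exists_relabel_threeCube (Nat.ofBits_lt_two_pow _)
    (hM.avoidsObstructions z hs)
    (by have := sum_testBit_traceMask M z hs; rw [himg] at this; exact h5.trans this.ge)
  refine ⟨cubePoint z s r, fun i hi => cubePoint_apply_of_forall_ne z s r fun k hk => hi ?_,
    s ∘ σ.symm, hs.comp σ.symm.injective, ?_, ?_⟩
  · exact hk ▸ ((T.equivFinOfCardEq hT).symm k).2
  · rw [← Finset.image_image, Finset.image_univ_equiv, himg]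
  · apply Nat.eq_of_testBit_eq
    intro q
    by_cases hq : q < 8
    · rw [← hσ q hq, testBit_traceMask M _ _ hq, ← cubePoint_ofBits_perm,
        cubePoint_cubePoint z hs]
      exact (testBit_traceMask M z s
        (Nat.xor_lt_two_pow hr (Nat.ofBits_lt_two_pow _))).symm
    · rw [traceMask, Nat.testBit_ofBits_ge _ _ (not_lt.1 hq), Nat.testBit_lt_two_pow]
      exact lt_of_lt_of_le (by norm_num) (Nat.pow_le_pow_right two_pos (not_lt.1 hq))

theorem traceMask_comp_castLE {h n d : ℕ} (hd : d ≤ n) (M : Finset (Fin h → Bool))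
    (z : Fin h → Bool) (s : Fin n → Fin h) :
    traceMask M z s % 2 ^ 2 ^ d = traceMask M z (s ∘ Fin.castLE hd) := by
  apply Nat.eq_of_testBit_eq
  intro q
  rw [Nat.testBit_mod_two_pow]
  by_cases hq : q < 2 ^ d
  · rw [testBit_traceMask M _ _ hq, cubePoint_comp_castLE hd z s hq,
      testBit_traceMask M z s (hq.trans_le (Nat.pow_le_pow_right two_pos hd))]
    simp [hq]
  · rw [traceMask, traceMask, Nat.testBit_ofBits_ge _ _ (not_lt.1 hq)]
    simp [hq]

/-- The bound of `sum_lt_of_refute_of_block_le` in terms of the number of points of `M` in a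
subcube. -/
theorem faceCard_lt_of_refute {h n B need : ℕ} {M : Finset (Fin h → Bool)}
    (hM : ObstructionFree M) (hn : 3 ≤ n) (hB : 2 ^ n = 8 * B) (z : Fin h → Bool)
    {s : Fin n → Fin h} (hs : Function.Injective s)
    (hlow : traceMask M z (s ∘ Fin.castLE hn) = 118)
    (hr : refute (2 ^ n) (obstructionTable n 8) 8 118 need = true) :
    faceCard M z (Finset.univ.image s) < need + 5 := by
  have hpos : 0 < 2 ^ n := by positivity
  rw [← sum_testBit_traceMask M z hs]
  exact sum_lt_of_refute_of_block_le hB (by omega) (hM.avoidsObstructions z hs)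
    ((traceMask_comp_castLE hn M z s).trans hlow)
    (fun j hj => traceMask_block_le hM hn z hs (by omega)) hr

theorem image_snoc {h n : ℕ} (s : Fin n → Fin h) (a : Fin h) :
    Finset.univ.image (Fin.snoc s a : Fin (n + 1) → Fin h) =
      insert a (Finset.univ.image s) := by
  ext i
  simp [Fin.exists_fin_succ', or_comm, eq_comm]

theorem snoc_injective {h n : ℕ} {s : Fin n → Fin h} (hs : Function.Injective s) {a : Fin h}
    (ha : a ∉ Finset.univ.image s) :
    Function.Injective (Fin.snoc s a : Fin (n + 1) → Fin h) := by
  exact Fin.snoc_injective_of_injective hs (by simpa using ha)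

theorem faceCard_fourCube_le {h : ℕ} {M : Finset (Fin h → Bool)} (hM : ObstructionFree M)
    (z : Fin h → Bool) {D : Finset (Fin h)} (hD : D.card = 4) : faceCard M z D ≤ 9 := by
  by_contra! hlt
  obtain ⟨a, T, haT, rfl, hT⟩ := Finset.card_eq_succ.1 hD
  -- One of the two 3-cubes with directions `T` has at least five of the ten points.
  obtain ⟨y, hy, hy5⟩ : ∃ y : Fin h → Bool, (∀ i ∉ insert a T, y i = z i) ∧
      5 ≤ faceCard M y T := by
    rw [faceCard_insert M z haT] at hlt
    by_cases h5 : 5 ≤ faceCard M z T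
    · exact ⟨z, fun _ _ => rfl, h5⟩
    · refine ⟨flipAt z a, fun i hi => flipAt_of_ne _ ?_, by omega⟩
      rintro rfl
      exact hi (Finset.mem_insert_self _ _)
  obtain ⟨z', hz', s, hs, rfl, h118⟩ := exists_normalized_threeCube hM y hT hy5
  have h1 := faceCard_lt_of_refute hM (by norm_num) (B := 2) (by norm_num) z'
    (snoc_injective hs haT) (by
      rw [← h118]
      congr 1
      funext k
      exact Fin.snoc_castSucc (α := fun _ => Fin h) a s k) refute_fourCube
  rw [image_snoc, faceCard_congr M (z := z)] at h1
  · omega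
  · intro i hi
    rw [hz' i fun hi' => hi (Finset.mem_insert_of_mem hi'), hy i hi]

theorem faceCard_fiveCube_le {h : ℕ} {M : Finset (Fin h → Bool)} (hM : ObstructionFree M)
    (z : Fin h → Bool) {D : Finset (Fin h)} (hD : D.card = 5) : faceCard M z D ≤ 16 := by
  by_contra! hlt
  obtain ⟨b, U, hbU, rfl, hU⟩ := Finset.card_eq_succ.1 hD
  obtain ⟨a, T, haT, rfl, hT⟩ := Finset.card_eq_succ.1 hU
  have haD : a ∈ insert b (insert a T) := by simp
  -- One of the four 3-cubes with directions `T` has at least five of the seventeen points.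
  obtain ⟨y, hy, hy5⟩ : ∃ y : Fin h → Bool, (∀ i ∉ insert b (insert a T), y i = z i) ∧
      5 ≤ faceCard M y T := by
    rw [faceCard_insert M z hbU, faceCard_insert M _ haT, faceCard_insert M _ haT] at hlt
    have hflip : ∀ (c : Fin h) (x : Fin h → Bool), c ∈ insert b (insert a T) →
        ∀ i ∉ insert b (insert a T), flipAt x c i = x i := by
      intro c x hc i hi
      exact flipAt_of_ne _ fun hic => hi (hic ▸ hc)
    by_contra! hcon
    have h1 := hcon z fun _ _ => rfl
    have h2 := hcon (flipAt z a) (hflip a z haD)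
    have h3 := hcon (flipAt z b) (hflip b z (by simp))
    have h4 := hcon (flipAt (flipAt z b) a) fun i hi => by
      rw [hflip a _ haD i hi, hflip b _ (by simp) i hi]
    omega
  obtain ⟨z', hz', s, hs, rfl, h118⟩ := exists_normalized_threeCube hM y hT hy5
  rw [← image_snoc] at hbU
  have h1 := faceCard_lt_of_refute hM (by norm_num) (B := 4) (by norm_num) z'
    (snoc_injective (snoc_injective hs haT) hbU) (by
      rw [← h118]
      congr 1
      funext k
      exact (Fin.snoc_castSucc (α := fun _ => Fin h) b _ k.castSucc).trans
        (Fin.snoc_castSucc (α := fun _ => Fin h) a s k)) refute_fiveCube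
  rw [image_snoc, image_snoc, faceCard_congr M (z := z)] at h1
  · omega
  · intro i hi
    rw [hz' i fun hi' => hi (by simp [hi']), hy i hi]

/-! ### Shortest paths in the hypercube -/

theorem flipAt_flipAt {h : ℕ} (x : Fin h → Bool) (i : Fin h) : flipAt (flipAt x i) i = x := by
  simp [flipAt]

theorem flipAt_ne {h : ℕ} (x : Fin h → Bool) (i : Fin h) : flipAt x i ≠ x := fun hx => by
  simpa using congrFun hx i

theorem hammingDist_eq_flipAt_add_one {h : ℕ} {x y : Fin h → Bool} {i : Fin h}
    (hi : x i ≠ y i) : hammingDist x y = hammingDist (flipAt x i) y + 1 := by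
  have h1 : (Finset.univ.filter fun j => x j ≠ y j) =
      insert i (Finset.univ.filter fun j => flipAt x i j ≠ y j) := by
    ext j
    by_cases hj : j = i
    · subst hj
      simp [hi]
    · simp [hj, flipAt_of_ne x hj]
  unfold hammingDist
  rw [h1, Finset.card_insert_of_notMem]
  simpa using hi

theorem hypercube_adj_iff {h : ℕ} {x y : Fin h → Bool} :
    (hypercube h).Adj x y ↔ ∃ i, y = flipAt x i := by
  change hammingDist x y = 1 ↔ _
  constructor
  · intro hxy
    have hne : x ≠ y := by
      rintro rfl
      simp at hxy
    obtain ⟨i, hi⟩ := Function.ne_iff.1 hne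
    rw [hammingDist_eq_flipAt_add_one hi] at hxy
    exact ⟨i, (hammingDist_eq_zero.1 (by omega)).symm⟩
  · rintro ⟨i, rfl⟩
    rw [hammingDist_eq_flipAt_add_one (i := i) (by simp), hammingDist_self]

theorem hammingDist_le_length {h : ℕ} {u v : Fin h → Bool} (p : (hypercube h).Walk u v) :
    hammingDist u v ≤ p.length := by
  induction p with
  | nil => simp
  | @cons u w v huw p ih =>
    have h1 : hammingDist u w = 1 := huw
    have h2 := hammingDist_triangle u w v
    rw [SimpleGraph.Walk.length_cons]
    omega

theorem exists_walk_length_eq_hammingDist {h : ℕ} (d : ℕ) :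
    ∀ u v : Fin h → Bool, hammingDist u v = d → ∃ p : (hypercube h).Walk u v, p.length = d := by
  induction d with
  | zero =>
    intro u v huv
    obtain rfl := hammingDist_eq_zero.1 huv
    exact ⟨SimpleGraph.Walk.nil, rfl⟩
  | succ d ih =>
    intro u v huv
    obtain ⟨i, hi⟩ := Function.ne_iff.1 (hammingDist_pos.1 (by omega : 0 < hammingDist u v))
    rw [hammingDist_eq_flipAt_add_one hi] at huv
    obtain ⟨p, hp⟩ := ih (flipAt u i) v (by omega)
    exact ⟨SimpleGraph.Walk.cons (hypercube_adj_iff.2 ⟨i, rfl⟩) p, by simp [hp]⟩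

theorem dist_hypercube {h : ℕ} (u v : Fin h → Bool) :
    (hypercube h).dist u v = hammingDist u v := by
  obtain ⟨p, hp⟩ := exists_walk_length_eq_hammingDist _ u v rfl
  obtain ⟨q, hq⟩ := p.reachable.exists_walk_length_eq_dist
  exact le_antisymm (hp ▸ SimpleGraph.dist_le p) (hq ▸ hammingDist_le_length q)

/-- A shortest path from `u` to `v ≠ u` starts by flipping a coordinate in which they differ, and
continues as a shortest path. -/
theorem exists_first_step {h : ℕ} {u v : Fin h → Bool} (p : (hypercube h).Walk u v)
    (hp : p.length = hammingDist u v) (huv : u ≠ v) :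
    ∃ i, u i ≠ v i ∧ ∃ q : (hypercube h).Walk (flipAt u i) v,
      q.length = hammingDist (flipAt u i) v ∧ ∀ x ∈ q.support, x ∈ p.support := by
  cases p with
  | nil => exact absurd rfl huv
  | cons huw q =>
    obtain ⟨i, rfl⟩ := hypercube_adj_iff.1 huw
    have hle := hammingDist_le_length q
    rw [SimpleGraph.Walk.length_cons] at hp
    have hi : u i ≠ v i := by
      intro hi
      have h1 := hammingDist_eq_flipAt_add_one (x := flipAt u i) (y := v) (i := i) (by simp [hi])
      rw [flipAt_flipAt] at h1
      omega
    refine ⟨i, hi, q, ?_, fun x hx => ?_⟩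
    · have := hammingDist_eq_flipAt_add_one hi
      omega
    · rw [SimpleGraph.Walk.support_cons]
      exact List.mem_cons_of_mem _ hx

/-! ### Consequences of mutual visibility -/

/-- If `c` and its neighbours in the directions `D` belong to `M`, then `M` has no other point in
the cube through `c` spanned by `D`: the first step of a shortest path from `c` to it would be a
leaf. -/
theorem eq_or_eq_flipAt_of_star {h : ℕ} {M : Finset (Fin h → Bool)}
    (hM : IsMutualVisibilitySet (hypercube h) (M : Set (Fin h → Bool))) {c : Fin h → Bool}
    (hc : c ∈ M) {D : Finset (Fin h)} (hD : ∀ i ∈ D, flipAt c i ∈ M) {v : Fin h → Bool}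
    (hv : v ∈ M) (hcv : ∀ i ∉ D, v i = c i) : v = c ∨ ∃ i ∈ D, v = flipAt c i := by
  by_cases hne : c = v
  · exact Or.inl hne.symm
  obtain ⟨p, -, hp, hpM⟩ := hM c hc v hv
  rw [dist_hypercube] at hp
  obtain ⟨i, hi, q, -, hq⟩ := exists_first_step p hp hne
  have hiD : i ∈ D := by
    by_contra hiD
    exact hi (hcv i hiD).symm
  have hnot := hpM _ (hq _ q.start_mem_support)
  refine Or.inr ⟨i, hiD, ?_⟩
  by_contra hvi
  exact hnot ⟨hD i hiD, by simp [flipAt_ne, Ne.symm hvi]⟩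

theorem IsMutualVisibilitySet.obstructionFree {h : ℕ} {M : Finset (Fin h → Bool)}
    (hM : IsMutualVisibilitySet (hypercube h) (M : Set (Fin h → Bool))) : ObstructionFree M where
  square x i j hij hx hi hj hv := by
    rcases eq_or_eq_flipAt_of_star hM hx (D := {i, j}) (by simp [hi, hj]) hv (by
      intro l hl
      simp only [Finset.mem_insert, Finset.mem_singleton, not_or] at hl
      rw [flipAt_of_ne _ hl.2, flipAt_of_ne _ hl.1]) with he | ⟨l, -, he⟩
    · have h2 := congrFun he j
      simp [flipAt_of_ne _ hij.symm] at h2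
    · have h1 := congrFun he i
      have h2 := congrFun he j
      simp only [flipAt_self, flipAt_of_ne _ hij, flipAt_of_ne _ hij.symm] at h1 h2
      by_cases hli : l = i
      · subst hli
        simp [flipAt_of_ne _ hij.symm] at h2
      · simp [flipAt_of_ne _ (Ne.symm hli)] at h1
  claw x i j k hij hik hjk hx hi hj hk hv := by
    rcases eq_or_eq_flipAt_of_star hM hx (D := {i, j, k}) (by simp [hi, hj, hk]) hv (by
      intro l hl
      simp only [Finset.mem_insert, Finset.mem_singleton, not_or] at hl
      rw [flipAt_of_ne _ hl.2.2, flipAt_of_ne _ hl.2.1, flipAt_of_ne _ hl.1]) with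
      he | ⟨l, -, he⟩
    · have h3 := congrFun he k
      simp [flipAt_of_ne _ hik.symm, flipAt_of_ne _ hjk.symm] at h3
    · have h1 := congrFun he i
      have h2 := congrFun he j
      simp only [flipAt_self, flipAt_of_ne _ hij, flipAt_of_ne _ hij.symm, flipAt_of_ne _ hik,
        flipAt_of_ne _ hjk] at h1 h2
      by_cases hli : l = i
      · subst hli
        simp [flipAt_of_ne _ hij.symm] at h2
      · simp [flipAt_of_ne _ (Ne.symm hli)] at h1
  hexagon x i j k hij hik hjk hi hj hk hij' hik' hv := by
    obtain ⟨p, -, hp, hpM⟩ := hM _ hi _ hv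
    rw [dist_hypercube] at hp
    have avoid : ∀ w ∈ M, w ∈ p.support →
        w = flipAt x i ∨ w = flipAt (flipAt x j) k := by
      intro w hw hwp
      by_contra hcon
      exact hpM w hwp ⟨hw, by simpa using hcon⟩
    obtain ⟨a, ha, q, hq, hqp⟩ := exists_first_step p hp fun he => by
      have := congrFun he i
      simp [flipAt_of_ne _ hij, flipAt_of_ne _ hik] at this
    have hw := hqp _ q.start_mem_support
    -- Only `x` is free among the neighbours of the starting point on shortest paths, so the path
    -- visits `x`; from there both ways on are blocked.
    have hai : a = i := by
      by_contra hai
      have hmem : flipAt (flipAt x i) a ∈ M := by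
        by_cases haj : a = j
        · exact haj ▸ hij'
        by_cases hak : a = k
        · exact hak ▸ hik'
        · exact absurd (by rw [flipAt_of_ne _ hai, flipAt_of_ne _ hak, flipAt_of_ne _ haj]) ha
      rcases avoid _ hmem hw with he | he
      · exact flipAt_ne _ _ he
      · have := congrFun he i
        simp [flipAt_of_ne _ hij, flipAt_of_ne _ hik, flipAt_of_ne _ (Ne.symm hai)] at this
    subst hai
    obtain ⟨b, hb, r, -, hrq⟩ := exists_first_step q hq fun he => by
      have := congrFun he j
      simp [flipAt_flipAt, flipAt_of_ne _ hjk] at this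
    have hw := hqp _ (hrq _ r.start_mem_support)
    rw [flipAt_flipAt] at hb hw
    have hbjk : b = j ∨ b = k := by
      by_contra! hcon
      exact hb (by rw [flipAt_of_ne _ hcon.2, flipAt_of_ne _ hcon.1])
    have hmem : flipAt x b ∈ M := by
      rcases hbjk with rfl | rfl
      · exact hj
      · exact hk
    have hba : b ≠ a := by
      rcases hbjk with rfl | rfl
      · exact hij.symm
      · exact hik.symm
    rcases avoid _ hmem hw with he | he
    · have := congrFun he b
      simp [flipAt_of_ne _ hba] at this
    · have h1 := congrFun he j
      have h2 := congrFun he k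
      rcases hbjk with rfl | rfl
      · simp [flipAt_of_ne _ hjk.symm] at h2
      · simp [flipAt_of_ne _ hjk] at h1

theorem faceCard_le_of_star {h : ℕ} {M : Finset (Fin h → Bool)}
    (hM : IsMutualVisibilitySet (hypercube h) (M : Set (Fin h → Bool))) {c : Fin h → Bool}
    (hc : c ∈ M) {D : Finset (Fin h)} (hD : ∀ i ∈ D, flipAt c i ∈ M) :
    faceCard M c D ≤ D.card + 1 := by
  refine le_trans (Finset.card_le_card (t := insert c (D.image (flipAt c))) fun v hv => ?_)
    ((Finset.card_insert_le _ _).trans (Nat.add_le_add_right Finset.card_image_le 1))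
  obtain ⟨hvM, hv⟩ := Finset.mem_filter.1 hv
  rcases eq_or_eq_flipAt_of_star hM hc hD hvM hv with rfl | ⟨i, hi, rfl⟩
  · exact Finset.mem_insert_self _ _
  · exact Finset.mem_insert_of_mem (Finset.mem_image_of_mem _ hi)

/-! ### The bound -/

theorem faceCard_univ {h : ℕ} (z : Fin h → Bool) (D : Finset (Fin h)) :
    faceCard Finset.univ z D = 2 ^ D.card := by
  induction D using Finset.induction_on generalizing z with
  | empty => simp [faceCard, ← funext_iff, Finset.filter_eq']
  | insert a D ha ih => rw [faceCard_insert _ _ ha, ih, ih, Finset.card_insert_of_notMem ha]; ring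

/-- Each point of `M` lies in the subcubes of `2 ^ |D|` base points `z`. -/
theorem sum_faceCard {h : ℕ} (M : Finset (Fin h → Bool)) (D : Finset (Fin h)) :
    ∑ z, faceCard M z D = M.card * 2 ^ D.card := by
  simp only [faceCard, Finset.card_filter]
  rw [Finset.sum_comm, ← smul_eq_mul, ← Finset.sum_const]
  refine Finset.sum_congr rfl fun x _ => ?_
  rw [← faceCard_univ x D, faceCard, Finset.card_filter]
  simp only [eq_comm]

/-- A copy of `K_{1,4}` in `M` is a vertex with its neighbours in four directions. -/
theorem exists_star {h : ℕ} {M Y : Finset (Fin h → Bool)} (hYM : Y ⊆ M)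
    (hY : Nonempty ((hypercube h).induce (Y : Set (Fin h → Bool)) ≃g
      completeBipartiteGraph (Fin 1) (Fin 4))) :
    ∃ c ∈ M, ∃ D : Finset (Fin h), D.card = 4 ∧ ∀ i ∈ D, flipAt c i ∈ M := by
  obtain ⟨e⟩ := hY
  have hadj : ∀ k : Fin 4, ∃ i, (e.symm (Sum.inr k) : Fin h → Bool) =
      flipAt (e.symm (Sum.inl 0) : Fin h → Bool) i := by
    intro k
    refine hypercube_adj_iff.1 ?_
    have : ((hypercube h).induce (Y : Set (Fin h → Bool))).Adj (e.symm (Sum.inl 0))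
        (e.symm (Sum.inr k)) := e.symm.map_adj_iff.2 (by simp)
    exact this
  choose d hd using hadj
  have hinj : Function.Injective d := by
    intro k l hkl
    have h1 : e.symm (Sum.inr k) = e.symm (Sum.inr l) :=
      Subtype.ext (by rw [hd k, hd l, hkl])
    exact Sum.inr_injective (e.symm.injective h1)
  refine ⟨_, hYM (e.symm (Sum.inl 0)).2, Finset.univ.image d, ?_, fun i hi => ?_⟩
  · rw [Finset.card_image_of_injective _ hinj]
    simp
  · obtain ⟨k, -, rfl⟩ := Finset.mem_image.1 hi
    rw [← hd k]
    exact hYM (e.symm (Sum.inr k)).2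

theorem mainTheorem12 (h : ℕ) (hh : 6 ≤ h) (M Y : Finset (Fin h → Bool))
    (hM : IsMutualVisibilitySet (hypercube h) (M : Set (Fin h → Bool)))
    (hYM : Y ⊆ M)
    (hY : Nonempty ((hypercube h).induce (Y : Set (Fin h → Bool)) ≃g
      completeBipartiteGraph (Fin 1) (Fin 4))) :
    M.card ≤ 2 ^ (h - 1) - 2 := by
  obtain ⟨c, hc, D, hD, hDM⟩ := exists_star hYM hY
  have hfree := hM.obstructionFree
  obtain ⟨a, ha⟩ : ∃ a, a ∉ D := by
    by_contra! hcon
    have := Finset.card_le_card (fun i _ => hcon i : Finset.univ ⊆ D)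
    rw [Finset.card_univ, Fintype.card_fin] at this
    omega
  have hcard : (insert a D).card = 5 := by rw [Finset.card_insert_of_notMem ha, hD]
  have h14 : faceCard M c (insert a D) ≤ 14 := by
    rw [faceCard_insert M c ha]
    have h1 := faceCard_le_of_star hM hc hDM
    have h2 := faceCard_fourCube_le hfree (flipAt c a) hD
    omega
  -- Summed over all base points `z`, every 5-cube with directions `insert a D` is counted 32 times;
  -- the one through `c` has at most 14 points, which accounts for the summand 2.
  have hle : ∀ z : Fin h → Bool,
      faceCard M z (insert a D) + (if ∀ i ∉ insert a D, z i = c i then 2 else 0) ≤ 16 := by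
    intro z
    split_ifs with hz
    · rw [faceCard_congr M hz]
      omega
    · exact faceCard_fiveCube_le hfree z hcard
  have hsum := Finset.sum_le_sum fun z (_ : z ∈ Finset.univ) => hle z
  have h32 : ∑ z : Fin h → Bool, (if ∀ i ∉ insert a D, z i = c i then 2 else 0) = 32 * 2 := by
    rw [← Finset.sum_filter, Finset.sum_const, smul_eq_mul]
    congr 1
    have := faceCard_univ c (insert a D)
    rw [hcard] at this
    exact this
  rw [Finset.sum_add_distrib, sum_faceCard, hcard, h32, Finset.sum_const, Finset.card_univ,
    Fintype.card_fun, Fintype.card_fin, Fintype.card_bool, smul_eq_mul] at hsum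
  obtain ⟨n, rfl⟩ : ∃ n, h = n + 1 := ⟨h - 1, by omega⟩
  rw [pow_succ] at hsum
  rw [Nat.add_sub_cancel]
  omega
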